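/- **Proposition.** Let $p\ge 1$, $m=p+2$, and let $\Sigma$ be a smooth two-dimensional manifold with a smooth immersion (in particular, embedding) $x=(x^1,\dots,x^m):\Sigma\to\mathbb{R}^m$ into Euclidean space. Let $\rho$ be a smooth nowhere vanishing density on $\Sigma$, i.e. a function $\rho(u)$ in each local coordinate system, with $\tilde\rho(v)=\left|\frac{\partial(u^1,u^2)}{\partial(v^1,v^2)}\right|\rho(u(v))$ under coordinate changes. In local coordinates $u^1,u^2$ on $\Sigma$ put $$\{f,h\}=\frac1\rho\,\varepsilon^{ab}(\partial_af)(\partial_bh)=\frac1\rho\bigl(\partial_1f\,\partial_2h-\partial_2f\,\partial_1h\bigr),\qquad g_{ab}=\langle\partial_ax,\partial_bx\rangle,\qquad g=\det(g_{ab}).$$ Let $K$ be the Gaussian curvature of $\Sigma$, i.e. the sectional curvature of the induced metric $g_{ab}$, and let $H=\frac12\sum_{A=1}^p(\operatorname{tr}W_A)N_A$ be the mean curvature vector, where $N_1,\dots,N_p$ is any orthonormal basis of the normal space, $(W_A)^a_b=g^{ac}h_{A,cb}$, and $h_{A,ab}$ is the $N_A$-component of the normal part of $\partial_a\partial_bx$.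 Then at every point, in all local coordinates, $$K=-\frac{\rho^4}{8g^2(p-1)!}\sum\varepsilon_{jklI}\,\varepsilon_{imnI}\,\{x^i,\{x^k,x^l\}\}\,\{x^j,\{x^m,x^n\}\},$$ $$H=\frac{\rho^4}{8g^2(p-1)!}\sum\varepsilon_{iklI}\,\varepsilon_{k'mnI}\,\{x^i,x^j\}\,\{x^j,\{x^k,x^l\}\}\,\{x^m,x^n\}\,\partial_{k'},$$ where all repeated indices are summed: $i,j,k,l,m,n,k'$ run over $1,\dots,\dim\mathbb{R}^m$, $I$ runs over all multi-indices $i_1\cdots i_{p-1}$ with entries in the same range, $\varepsilon$ is the Levi-Civita symbol, and $\partial_{k'}$ is the $k'$-th standard basis vector of $\mathbb{R}^m$. -/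

import Mathlib

open scoped ContDiff Manifold

noncomputable section

/-- Euclidean space `ℝ^n`. -/
abbrev Euc (n : ℕ) : Type := EuclideanSpace ℝ (Fin n)

/-- The partial derivative `∂_a f` of a function of the two local coordinates `(u^1, u^2)`
(numbered `0, 1`). -/
def pd {F : Type*} [NormedAddCommGroup F] [NormedSpace ℝ F]
    (a : Fin 2) (f : Euc 2 → F) (u : Euc 2) : F :=
  fderiv ℝ f u (EuclideanSpace.single a (1 : ℝ))

/-- A smooth nowhere vanishing density on a surface `S`: a coordinate expression `ρ_φ` for each
smooth chart `φ`, where `ρ_ψ(v) = |∂u/∂v| ρ_φ(u(v))` on overlaps of charts. -/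
structure NonvanishingDensity (S : Type*) [TopologicalSpace S] [ChartedSpace (Euc 2) S] where
  /-- The coordinate expression of the density in a chart. -/
  coord : OpenPartialHomeomorph S (Euc 2) → Euc 2 → ℝ
  contDiffOn_coord : ∀ φ ∈ IsManifold.maximalAtlas (𝓡 2) ∞ S,
    ContDiffOn ℝ ∞ (coord φ) φ.target
  coord_ne_zero : ∀ φ ∈ IsManifold.maximalAtlas (𝓡 2) ∞ S, ∀ u ∈ φ.target, coord φ u ≠ 0
  coord_change : ∀ φ ∈ IsManifold.maximalAtlas (𝓡 2) ∞ S,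
    ∀ ψ ∈ IsManifold.maximalAtlas (𝓡 2) ∞ S, ∀ v ∈ ψ.target, ψ.symm v ∈ φ.source →
      coord ψ v = |(fderiv ℝ (fun w => φ (ψ.symm w)) v).det| * coord φ (φ (ψ.symm v))

/-- The Poisson bracket `{f, h} = (1/ρ) ε^{ab} (∂_a f) (∂_b h)` in local coordinates. -/
def poissonBracket (ρ f h : Euc 2 → ℝ) (u : Euc 2) : ℝ :=
  (1 / ρ u) * (pd 0 f u * pd 1 h u - pd 1 f u * pd 0 h u)

/-- The Levi-Civita symbol `ε_{i_1 ⋯ i_n}`. -/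
def leviCivita {n : ℕ} (v : Fin n → Fin n) : ℝ :=
  open Classical in
  if h : Function.Bijective v then ((Equiv.Perm.sign (Equiv.ofBijective v h) : ℤ) : ℝ) else 0

/-- The symbol `ε_{jklI}` for a multi-index `I` of length `n - 3`. -/
def leviCivita₃ {q : ℕ} (j k l : Fin (q + 3)) (I : Fin q → Fin (q + 3)) : ℝ :=
  leviCivita (Matrix.vecCons j (Matrix.vecCons k (Matrix.vecCons l I)))

section Surface

variable {n : ℕ} (X : Euc 2 → Euc n)

/-- The induced metric `g_{ab} = ⟨e_a, e_b⟩`, `e_a = ∂_a X`, of a parametrized surface `X`. -/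
def inducedMetric (u : Euc 2) : Matrix (Fin 2) (Fin 2) ℝ :=
  fun a b => inner ℝ (pd a X u) (pd b X u)

/-- The Christoffel symbols `Γ^c_{ab}` of the Levi-Civita connection of the induced metric. -/
def christoffel (c a b : Fin 2) (u : Euc 2) : ℝ :=
  (1 / 2) * ∑ d, (inducedMetric X u)⁻¹ c d *
    (pd a (fun v => inducedMetric X v d b) u + pd b (fun v => inducedMetric X v d a) u
      - pd d (fun v => inducedMetric X v a b) u)

/-- The component along `e_d` of `R(e_a, e_b) e_c = ∇_a ∇_b e_c - ∇_b ∇_a e_c`, where `R` is the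
Riemann curvature tensor of the induced metric. -/
def riemannCurvature (d c a b : Fin 2) (u : Euc 2) : ℝ :=
  pd a (christoffel X d b c) u - pd b (christoffel X d a c) u
    + ∑ e, (christoffel X d a e u * christoffel X e b c u
      - christoffel X d b e u * christoffel X e a c u)

/-- The Gaussian curvature: the sectional curvature
`g(R(e_1, e_2) e_2, e_1) / (g(e_1, e_1) g(e_2, e_2) - g(e_1, e_2)^2)` of the induced metric. -/
def gaussianCurvature (u : Euc 2) : ℝ :=
  (∑ d, riemannCurvature X d 1 0 1 u * inducedMetric X u d 0) / (inducedMetric X u).det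

/-- The normal space of the surface at the point with coordinates `u`. -/
def normalSpace (u : Euc 2) : Submodule ℝ (Euc n) :=
  (Submodule.span ℝ (Set.range fun a : Fin 2 => pd a X u))ᗮ

/-- The second fundamental form `α(e_a, e_b)`: the normal part of `∂_a e_b`. -/
def secondFundamentalForm (a b : Fin 2) (u : Euc 2) : normalSpace X u :=
  (normalSpace X u).orthogonalProjectionOnto (pd a (pd b X) u)

/-- The matrix `(W_A)^a_b = g^{ac} h_{A,cb}` of the Weingarten map of a normal vector `N`, where
`h_{A,ab}` is the component of `α(e_a, e_b)` along `N`. -/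
def weingarten {u : Euc 2} (N : normalSpace X u) : Matrix (Fin 2) (Fin 2) ℝ :=
  (inducedMetric X u)⁻¹ * Matrix.of fun a b => inner ℝ (secondFundamentalForm X a b u) N

/-- The mean curvature vector `H = (1/2) ∑_A (tr W_A) N_A`, computed in an orthonormal basis `N_A`
of the normal space. -/
def meanCurvatureVector {p : ℕ} {u : Euc 2} (N : OrthonormalBasis (Fin p) ℝ (normalSpace X u)) :
    Euc n :=
  (1 / 2 : ℝ) • ∑ A, (weingarten X (N A)).trace • (N A : Euc n)

end Surface

end

/-! Put q = p - 1, so that the ambient dimension is q + 3, and write e_a = ∂_a X, z_ab = ∂_a ∂_b X,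
r_a = ∂_a ρ / ρ. In a chart both formulas reduce to algebra in the inner products and components of
these vectors.

Summing over I turns the product of the two Levi-Civita symbols into q! times a 3 × 3 determinant of
Kronecker deltas (`sum_leviCivita₃_mul_leviCivita₃`). By the product rule, {x^i, {x^k, x^l}} is ρ⁻²
times the tensor e₀ ⊗ (z₀₁ ∧ e₁ + e₀ ∧ (z₁₁ - r₁ e₁)) - e₁ ⊗ (z₀₀ ∧ e₁ + e₀ ∧ (z₀₁ - r₀ e₁)), a sum
of four terms a ⊗ (b ∧ c) (`poissonBracket_poissonBracket_coord`), while {x^i, x^j} is ρ⁻¹ e₀ ∧ e₁.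
Contracting with the delta gives 4 times a sum of Gram determinants for K, and of bordered Gram
determinants for H.

In these sums the r_a cancel (`sum_gram_det_eq`, `sum_bordered_gram_det_eq`). What remains is -2g²K
by the Gauss equation (`gaussianCurvature_eq`), respectively the components of g² g^{ab} α_ab =
2g²H. With the factor 4 this accounts for ∓8g². -/

/-! ### Contraction of Levi-Civita symbols. -/

/-- The generalized Kronecker delta `det (δ_{J_a J'_b})`. -/
def generalizedKronecker {ι κ : Type*} [Fintype ι] [DecidableEq ι] [DecidableEq κ]
    (J J' : ι → κ) : ℝ :=
  (Matrix.of fun a b => if J a = J' b then (1 : ℝ) else 0).det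

theorem generalizedKronecker_comp_equiv {ι ι' κ : Type*} [Fintype ι] [DecidableEq ι] [Fintype ι']
    [DecidableEq ι'] [DecidableEq κ] (e : ι' ≃ ι) (J J' : ι → κ) :
    generalizedKronecker (J ∘ e) (J' ∘ e) = generalizedKronecker J J' :=
  Matrix.det_submatrix_equiv_self e (Matrix.of fun a b => if J a = J' b then (1 : ℝ) else 0)

/-- Expand over permutations of `Option ι`. Those fixing `none` leave a free sum over i, worth `card
κ`. Those of the form (none a)τ link J a = i = J' (τ⁻¹ a), which restores the term of τ with the
opposite sign, once for each a in ι. -/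
theorem sum_generalizedKronecker_option {ι κ : Type*} [Fintype ι] [DecidableEq ι] [Fintype κ]
    [DecidableEq κ] (J J' : ι → κ) :
    ∑ i, generalizedKronecker (fun o : Option ι => o.elim i J) (fun o => o.elim i J') =
      ((Fintype.card κ : ℝ) - Fintype.card ι) * generalizedKronecker J J' := by
  have key : ∀ (a : ι) (τ : Equiv.Perm ι),
      ∑ i, ∏ o : Option ι,
        (if ((Equiv.swap none (some a) * Equiv.optionCongr τ) o).elim i J = o.elim i J'
          then (1 : ℝ) else 0) =
        ∏ b, if J (τ b) = J' b then (1 : ℝ) else 0 := by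
    intro a τ
    have hfac : ∀ i, ∏ o : Option ι,
        (if ((Equiv.swap none (some a) * Equiv.optionCongr τ) o).elim i J = o.elim i J'
          then (1 : ℝ) else 0) =
        (if J a = i then 1 else 0) * ((if i = J' (τ.symm a) then 1 else 0) *
          ∏ b ∈ Finset.univ.erase (τ.symm a), if J (τ b) = J' b then (1 : ℝ) else 0) := by
      intro i
      rw [Fintype.prod_option]
      refine congrArg₂ _ (by simp) ?_
      · rw [← Finset.mul_prod_erase _ _ (Finset.mem_univ (τ.symm a))]
        refine congrArg₂ _ (by simp) ?_
        · refine Finset.prod_congr rfl fun b hb => ?_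
          have hne : τ b ≠ a := by
            rintro rfl
            simp at hb
          simp [Equiv.swap_apply_of_ne_of_ne, hne]
    simp_rw [hfac]
    rw [Finset.sum_eq_single (J a) (fun i _ hi => by simp [hi.symm]) (by simp),
      ← Finset.mul_prod_erase _ _ (Finset.mem_univ (τ.symm a))]
    simp
  have key₀ : ∀ τ : Equiv.Perm ι,
      ∑ i, ∏ o : Option ι,
        (if (Equiv.optionCongr τ o).elim i J = o.elim i J' then (1 : ℝ) else 0) =
        Fintype.card κ * ∏ b, if J (τ b) = J' b then (1 : ℝ) else 0 := by
    intro τ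
    have h : ∀ i, ∏ o : Option ι,
        (if (Equiv.optionCongr τ o).elim i J = o.elim i J' then (1 : ℝ) else 0) =
        ∏ b, if J (τ b) = J' b then (1 : ℝ) else 0 := by
      intro i
      rw [Fintype.prod_option]
      exact (congrArg₂ _ (if_pos rfl) rfl).trans (one_mul _)
    rw [Finset.sum_congr rfl fun i _ => h i]
    simp
  simp only [generalizedKronecker, Matrix.det_apply', Matrix.of_apply]
  -- Every permutation of `Option ι` is uniquely a swap of `none` with some element (possibly
  -- itself) times a permutation of ι.
  rw [Finset.sum_comm, ← Equiv.sum_comp Equiv.Perm.decomposeOption.symm, Fintype.sum_prod_type,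
    Fintype.sum_option]
  simp only [Equiv.Perm.decomposeOption_symm_apply, Equiv.Perm.sign_mul, ← Finset.mul_sum, key,
    Equiv.swap_self, ← Equiv.Perm.one_def, one_mul, key₀,
    Equiv.Perm.sign_swap (Option.some_ne_none _).symm, Equiv.optionCongr_sign,
    Units.val_neg, Int.cast_neg, neg_mul, Finset.sum_neg_distrib, Finset.sum_const,
    Finset.card_univ, nsmul_eq_mul, mul_left_comm _ (Fintype.card κ : ℝ)]
  ring

/-- Contract one index at a time. The dimension condition makes the successive factors 1, 2, …, s,
whence the factorial. -/
theorem sum_generalizedKronecker_sum {κ : Type*} [Fintype κ] [DecidableEq κ] (s : ℕ) :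
    ∀ {ι : Type} [Fintype ι] [DecidableEq ι] (J J' : ι → κ),
      Fintype.card κ = Fintype.card ι + s →
      ∑ I : Fin s → κ, generalizedKronecker (Sum.elim J I) (Sum.elim J' I) =
        (s.factorial : ℝ) * generalizedKronecker J J' := by
  induction s with
  | zero =>
    intro ι _ _ J J' _
    have h := generalizedKronecker_comp_equiv (Equiv.sumEmpty ι (Fin 0)) J J'
    rw [Fintype.sum_unique, Nat.factorial_zero, Nat.cast_one, one_mul, ← h]
    congr 1 <;> · ext a; rcases a with a | a; · rfl
                  · exact a.elim0
  | succ s ih =>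
    intro ι _ _ J J' hcard
    -- The first of the s + 1 summed indices becomes the extra point of `Option ι`, to be contracted
    -- after the induction hypothesis has removed the other s.
    let e : ι ⊕ Fin (s + 1) ≃ Option ι ⊕ Fin s :=
      { toFun := Sum.elim (fun a => Sum.inl (some a))
          (Fin.cases (Sum.inl none) (fun b => Sum.inr b))
        invFun := Sum.elim (fun o => o.elim (Sum.inr 0) Sum.inl) (fun b => Sum.inr b.succ)
        left_inv := by
          rintro (a | b)
          · rfl
          · cases b using Fin.cases <;> rfl
        right_inv := by rintro ((_ | a) | b) <;> rfl }
    have he : ∀ (J : ι → κ) (i : κ) (I : Fin s → κ),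
        Sum.elim J (Fin.cons i I : Fin (s + 1) → κ) =
          Sum.elim (fun o : Option ι => o.elim i J) I ∘ e := by
      intro J i I
      ext a
      rcases a with a | b
      · rfl
      · cases b using Fin.cases <;> rfl
    rw [← Equiv.sum_comp (Fin.consEquiv fun _ : Fin (s + 1) => κ), Fintype.sum_prod_type]
    have h' : ∀ (i : κ) (I : Fin s → κ),
        (Fin.consEquiv fun _ : Fin (s + 1) => κ) (i, I) = Fin.cons i I := fun _ _ => rfl
    simp only [h', he, generalizedKronecker_comp_equiv]
    have hcard' : Fintype.card κ = Fintype.card (Option ι) + s := by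
      rw [Fintype.card_option]; omega
    simp_rw [ih _ _ hcard', ← Finset.mul_sum, sum_generalizedKronecker_option]
    rw [hcard, Nat.factorial_succ]
    push_cast
    ring

theorem leviCivita_eq_det {n : ℕ} (v : Fin n → Fin n) :
    leviCivita v = (Matrix.of fun a b => if v a = b then (1 : ℝ) else 0).det := by
  unfold leviCivita
  split_ifs with h
  · rw [← Matrix.det_permutation]
    congr 1
    ext a b
    simp [Equiv.Perm.permMatrix, PEquiv.toMatrix_apply, eq_comm]
  · have hinj : ¬ Function.Injective v := fun hi => h (Finite.injective_iff_bijective.mp hi)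
    simp only [Function.Injective, not_forall] at hinj
    obtain ⟨a, b, hab, hne⟩ := hinj
    exact (Matrix.det_zero_of_row_eq hne (by ext c; simp [hab])).symm

/-- Each symbol is the determinant of a matrix with rows δ_{v a, ·}, and the product of one such
matrix with the transpose of the other has entries δ_{v a, w b}. -/
theorem leviCivita_mul_leviCivita {n : ℕ} (v w : Fin n → Fin n) :
    leviCivita v * leviCivita w = generalizedKronecker v w := by
  rw [leviCivita_eq_det, leviCivita_eq_det, ← Matrix.det_transpose (Matrix.of fun a b => if w a = b
    then (1 : ℝ) else 0), ← Matrix.det_mul, generalizedKronecker]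
  congr 1
  ext a b
  simp [Matrix.mul_apply, eq_comm]

theorem sum_leviCivita₃_mul_leviCivita₃ {q : ℕ} (j k l i m n : Fin (q + 3)) :
    ∑ I, leviCivita₃ j k l I * leviCivita₃ i m n I =
      (q.factorial : ℝ) * generalizedKronecker ![j, k, l] ![i, m, n] := by
  let e : Fin 3 ⊕ Fin q ≃ Fin (q + 3) :=
    finSumFinEquiv.trans (finCongr (Nat.add_comm 3 q))
  have he : ∀ (j k l : Fin (q + 3)) (I : Fin q → Fin (q + 3)),
      (Matrix.vecCons j (Matrix.vecCons k (Matrix.vecCons l I)) : Fin (q + 3) → Fin (q + 3)) ∘ e =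
        Sum.elim ![j, k, l] I := by
    intro j k l I
    ext a
    rcases a with a | b
    · fin_cases a <;> rfl
    · have : e (Sum.inr b) = b.succ.succ.succ := by
        ext
        simp [e]
      simp [this]
  rw [← sum_generalizedKronecker_sum q ![j, k, l] ![i, m, n] (by simp [Nat.add_comm])]
  refine Finset.sum_congr rfl fun I _ => ?_
  rw [leviCivita₃, leviCivita₃, leviCivita_mul_leviCivita, ← he, ← he,
    generalizedKronecker_comp_equiv]

/-! ### Contraction of tensors with the three-index delta. -/

section
open Matrix

theorem det_of_fin_three (x₁ x₂ x₃ y₁ y₂ y₃ z₁ z₂ z₃ : ℝ) :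
    !![x₁, y₁, z₁; x₂, y₂, z₂; x₃, y₃, z₃].det =
      x₁ * y₂ * z₃ - x₁ * z₂ * y₃ - y₁ * x₂ * z₃ + y₁ * z₂ * x₃ + z₁ * x₂ * y₃ -
        z₁ * y₂ * x₃ := by
  simp [det_fin_three]

theorem sum_det_fin_three_col {κ : Type*} [Fintype κ] (x₁ x₂ x₃ y₁ y₂ y₃ : ℝ) (c f g h : κ → ℝ) :
    ∑ n, (!![x₁, y₁, f n; x₂, y₂, g n; x₃, y₃, h n].det * c n) =
      !![x₁, y₁, ∑ n, f n * c n; x₂, y₂, ∑ n, g n * c n; x₃, y₃, ∑ n, h n * c n].det := by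
  simp only [det_of_fin_three, Finset.mul_sum, Finset.sum_mul, ← Finset.sum_add_distrib,
    ← Finset.sum_sub_distrib]
  exact Finset.sum_congr rfl fun n _ => by ring

/-- Multilinearity of the determinant: the sums over n and m act on the last two columns, those over
l and k on the last two rows. `hcol` and `htr` bring the affected row or column into last-column
position. -/
theorem sum_generalizedKronecker_mul {κ : Type*} [Fintype κ] [DecidableEq κ] (i j : κ)
    (b c b' c' : κ → ℝ) :
    ∑ k, ∑ l, ∑ m, ∑ n, generalizedKronecker ![j, k, l] ![i, m, n] *
        (b k * c l * (b' m * c' n)) =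
      !![if j = i then 1 else 0, b' j, c' j; b i, b ⬝ᵥ b', b ⬝ᵥ c'; c i, c ⬝ᵥ b', c ⬝ᵥ c'].det := by
  have hcol : ∀ x₁ x₂ x₃ y₁ y₂ y₃ z₁ z₂ z₃ : ℝ, !![x₁, y₁, z₁; x₂, y₂, z₂; x₃, y₃, z₃].det =
      -!![x₁, z₁, y₁; x₂, z₂, y₂; x₃, z₃, y₃].det := by
    intros
    simp only [det_of_fin_three]
    ring
  have htr : ∀ x₁ x₂ x₃ y₁ y₂ y₃ z₁ z₂ z₃ : ℝ, !![x₁, y₁, z₁; x₂, y₂, z₂; x₃, y₃, z₃].det =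
      !![x₁, x₂, x₃; y₁, y₂, y₃; z₁, z₂, z₃].det := by
    intros
    simp only [det_of_fin_three]
    ring
  have h₀ : ∀ k l m n, generalizedKronecker ![j, k, l] ![i, m, n] =
      !![if j = i then 1 else 0, if j = m then 1 else 0, if j = n then 1 else 0;
        if k = i then 1 else 0, if k = m then 1 else 0, if k = n then 1 else 0;
        if l = i then 1 else 0, if l = m then 1 else 0, if l = n then 1 else 0].det := by
    intro k l m n
    rw [generalizedKronecker]
    congr 1
    ext x y
    fin_cases x <;> fin_cases y <;> rfl
  have h₁ : ∀ k l m, ∑ n, generalizedKronecker ![j, k, l] ![i, m, n] * c' n =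
      !![if j = i then 1 else 0, if j = m then 1 else 0, c' j;
        if k = i then 1 else 0, if k = m then 1 else 0, c' k;
        if l = i then 1 else 0, if l = m then 1 else 0, c' l].det := by
    intro k l m
    simp_rw [h₀, sum_det_fin_three_col]
    simp
  have h₂ : ∀ k l, ∑ m, !![if j = i then 1 else 0, if j = m then 1 else 0, c' j;
        if k = i then 1 else 0, if k = m then 1 else 0, c' k;
        if l = i then 1 else 0, if l = m then 1 else 0, c' l].det * b' m =
      !![if j = i then 1 else 0, b' j, c' j;
        if k = i then 1 else 0, b' k, c' k; if l = i then 1 else 0, b' l, c' l].det := by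
    intro k l
    simp_rw [hcol _ _ _ _ _ _ (c' j), neg_mul, Finset.sum_neg_distrib, sum_det_fin_three_col]
    simp
  have h₃ : ∀ k, ∑ l, !![if j = i then 1 else 0, b' j, c' j;
        if k = i then 1 else 0, b' k, c' k; if l = i then 1 else 0, b' l, c' l].det * c l =
      !![if j = i then 1 else 0, b' j, c' j;
        if k = i then 1 else 0, b' k, c' k; c i, c ⬝ᵥ b', c ⬝ᵥ c'].det := by
    intro k
    simp_rw [htr _ _ _ (b' j), sum_det_fin_three_col]
    simp [dotProduct, mul_comm]
  have h₄ : ∑ k, !![if j = i then 1 else 0, b' j, c' j;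
        if k = i then 1 else 0, b' k, c' k; c i, c ⬝ᵥ b', c ⬝ᵥ c'].det * b k =
      !![if j = i then 1 else 0, b' j, c' j; b i, b ⬝ᵥ b', b ⬝ᵥ c'; c i, c ⬝ᵥ b', c ⬝ᵥ c'].det := by
    simp_rw [htr _ _ _ (b' j), hcol _ _ _ _ _ _ (c i), neg_mul, Finset.sum_neg_distrib,
      sum_det_fin_three_col]
    simp [dotProduct, mul_comm]
  rw [← h₄]
  simp_rw [← h₃, ← h₂, ← h₁, Finset.sum_mul]
  refine Finset.sum_congr rfl fun k _ => Finset.sum_congr rfl fun l _ =>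
    Finset.sum_congr rfl fun m _ => Finset.sum_congr rfl fun n _ => ?_
  ring

/-- The delta is antisymmetric in k, l and in m, n, so the four terms of the product contribute
equally. -/
theorem sum_generalizedKronecker_mul_wedge {κ : Type*} [Fintype κ] [DecidableEq κ] (i j : κ)
    (b c b' c' : κ → ℝ) :
    ∑ k, ∑ l, ∑ m, ∑ n, generalizedKronecker ![j, k, l] ![i, m, n] *
        ((b k * c l - b l * c k) * (b' m * c' n - b' n * c' m)) =
      4 * !![if j = i then 1 else 0, b' j, c' j; b i, b ⬝ᵥ b', b ⬝ᵥ c';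
        c i, c ⬝ᵥ b', c ⬝ᵥ c'].det := by
  have h : ∀ k l m n, generalizedKronecker ![j, k, l] ![i, m, n] *
        ((b k * c l - b l * c k) * (b' m * c' n - b' n * c' m)) =
      generalizedKronecker ![j, k, l] ![i, m, n] * (b k * c l * (b' m * c' n)) -
      generalizedKronecker ![j, k, l] ![i, m, n] * (c k * b l * (b' m * c' n)) -
      generalizedKronecker ![j, k, l] ![i, m, n] * (b k * c l * (c' m * b' n)) +
      generalizedKronecker ![j, k, l] ![i, m, n] * (c k * b l * (c' m * b' n)) := by
    intros
    ring
  simp_rw [h, Finset.sum_add_distrib, Finset.sum_sub_distrib, sum_generalizedKronecker_mul,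
    det_of_fin_three]
  ring

theorem sum_sum_mul_det_fin_three {κ : Type*} [Fintype κ] [DecidableEq κ]
    (a b c a' b' c' : κ → ℝ) :
    ∑ i, ∑ j, !![if j = i then 1 else 0, b' j, c' j; b i, b ⬝ᵥ b', b ⬝ᵥ c';
        c i, c ⬝ᵥ b', c ⬝ᵥ c'].det * (a i * a' j) =
      !![a' ⬝ᵥ a, a' ⬝ᵥ b', a' ⬝ᵥ c'; b ⬝ᵥ a, b ⬝ᵥ b', b ⬝ᵥ c';
        c ⬝ᵥ a, c ⬝ᵥ b', c ⬝ᵥ c'].det := by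
  set P := b ⬝ᵥ b'
  set Q := b ⬝ᵥ c'
  set R := c ⬝ᵥ b'
  set T := c ⬝ᵥ c'
  have h : ∀ i j, !![if j = i then 1 else 0, b' j, c' j; b i, P, Q; c i, R, T].det *
      (a i * a' j) = (P * T - Q * R) * ((if j = i then a' j else 0) * a i) -
      T * ((b i * a i) * (a' j * b' j)) + Q * ((c i * a i) * (a' j * b' j)) +
      R * ((b i * a i) * (a' j * c' j)) - P * ((c i * a i) * (a' j * c' j)) := by
    intro i j
    rw [det_of_fin_three]
    split_ifs <;> ring
  simp only [h]
  simp only [Finset.sum_add_distrib, Finset.sum_sub_distrib, ← Finset.mul_sum,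
    ← Finset.sum_mul, det_of_fin_three, dotProduct]
  simp only [Finset.sum_ite_eq', Finset.mem_univ, if_true]
  ring

/-- The contraction of the tensor `∑ a ⊗ (b ∧ c)` with itself by the generalized Kronecker delta,
the first slots being exchanged, is a sum of Gram determinants. -/
theorem sum_generalizedKronecker_mul_crossed {σ κ : Type*} [Fintype σ] [Fintype κ] [DecidableEq κ]
    (a b c : σ → κ → ℝ) :
    ∑ i, ∑ j, ∑ k, ∑ l, ∑ m, ∑ n, generalizedKronecker ![j, k, l] ![i, m, n] *
        (∑ s, a s i * (b s k * c s l - b s l * c s k)) *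
        (∑ t, a t j * (b t m * c t n - b t n * c t m)) =
      4 * ∑ s, ∑ t, !![a t ⬝ᵥ a s, a t ⬝ᵥ b t, a t ⬝ᵥ c t; b s ⬝ᵥ a s, b s ⬝ᵥ b t, b s ⬝ᵥ c t;
        c s ⬝ᵥ a s, c s ⬝ᵥ b t, c s ⬝ᵥ c t].det := by
  have h : ∀ i j k l m n, generalizedKronecker ![j, k, l] ![i, m, n] *
        (∑ s, a s i * (b s k * c s l - b s l * c s k)) *
        (∑ t, a t j * (b t m * c t n - b t n * c t m)) =
      ∑ s, ∑ t, generalizedKronecker ![j, k, l] ![i, m, n] *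
        ((b s k * c s l - b s l * c s k) * (b t m * c t n - b t n * c t m)) *
        (a s i * a t j) := by
    intro i j k l m n
    rw [mul_assoc, Finset.sum_mul_sum, Finset.mul_sum]
    refine Finset.sum_congr rfl fun s _ => ?_
    rw [Finset.mul_sum]
    exact Finset.sum_congr rfl fun t _ => by ring
  simp_rw [h]
  have hcomm : ∀ f : κ → σ → σ → ℝ, ∑ k, ∑ s, ∑ t, f k s t = ∑ s, ∑ t, ∑ k, f k s t := by
    intro f
    rw [Finset.sum_comm]
    exact Finset.sum_congr rfl fun s _ => Finset.sum_comm
  simp_rw [hcomm, ← Finset.sum_mul, sum_generalizedKronecker_mul_wedge, mul_assoc (4 : ℝ),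
    ← Finset.mul_sum, sum_sum_mul_det_fin_three]

/-- The contraction of `(e₀ ∧ e₁) ⬝ (∑ a ⊗ (b ∧ c))` with the bivector `e₀ ∧ e₁` by the
generalized Kronecker delta is a sum of bordered Gram determinants. -/
theorem sum_generalizedKronecker_mul_bivector {σ κ : Type*} [Fintype σ] [Fintype κ]
    [DecidableEq κ] (e₀ e₁ : κ → ℝ) (a b c : σ → κ → ℝ) (k' : κ) :
    ∑ i, ∑ j, ∑ k, ∑ l, ∑ m, ∑ n, generalizedKronecker ![i, k, l] ![k', m, n] *
        (e₀ i * e₁ j - e₀ j * e₁ i) *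
        (∑ s, a s j * (b s k * c s l - b s l * c s k)) *
        (e₀ m * e₁ n - e₀ n * e₁ m) =
      4 * ∑ s, ((e₁ ⬝ᵥ a s) * !![e₀ k', e₀ ⬝ᵥ e₀, e₀ ⬝ᵥ e₁; b s k', b s ⬝ᵥ e₀, b s ⬝ᵥ e₁;
          c s k', c s ⬝ᵥ e₀, c s ⬝ᵥ e₁].det -
        (e₀ ⬝ᵥ a s) * !![e₁ k', e₁ ⬝ᵥ e₀, e₁ ⬝ᵥ e₁; b s k', b s ⬝ᵥ e₀, b s ⬝ᵥ e₁;
          c s k', c s ⬝ᵥ e₀, c s ⬝ᵥ e₁].det) := by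
  have h : ∀ i j k l m n, generalizedKronecker ![i, k, l] ![k', m, n] *
        (e₀ i * e₁ j - e₀ j * e₁ i) *
        (∑ s, a s j * (b s k * c s l - b s l * c s k)) *
        (e₀ m * e₁ n - e₀ n * e₁ m) =
      ∑ s, generalizedKronecker ![i, k, l] ![k', m, n] *
        ((b s k * c s l - b s l * c s k) * (e₀ m * e₁ n - e₀ n * e₁ m)) *
        (a s j * (e₀ i * e₁ j - e₀ j * e₁ i)) := by
    intro i j k l m n
    rw [Finset.mul_sum, Finset.sum_mul]
    exact Finset.sum_congr rfl fun t _ => by ring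
  simp_rw [h]
  have hcomm : ∀ f : κ → σ → ℝ, ∑ k, ∑ s, f k s = ∑ s, ∑ k, f k s := fun f => Finset.sum_comm
  simp_rw [hcomm, ← Finset.sum_mul, sum_generalizedKronecker_mul_wedge, mul_assoc (4 : ℝ),
    ← Finset.mul_sum]
  congr 1
  refine Finset.sum_congr rfl fun s _ => ?_
  have hj : ∀ i, ∑ j, a s j * (e₀ i * e₁ j - e₀ j * e₁ i) =
      (e₁ ⬝ᵥ a s) * e₀ i - (e₀ ⬝ᵥ a s) * e₁ i := by
    intro i
    simp_rw [dotProduct, Finset.sum_mul, ← Finset.sum_sub_distrib]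
    exact Finset.sum_congr rfl fun t _ => by ring
  simp_rw [hj]
  have hrow : ∀ e : κ → ℝ, ∑ i, !![if i = k' then 1 else 0, e₀ i, e₁ i;
      b s k', b s ⬝ᵥ e₀, b s ⬝ᵥ e₁; c s k', c s ⬝ᵥ e₀, c s ⬝ᵥ e₁].det * e i =
      !![e k', e ⬝ᵥ e₀, e ⬝ᵥ e₁; b s k', b s ⬝ᵥ e₀, b s ⬝ᵥ e₁;
          c s k', c s ⬝ᵥ e₀, c s ⬝ᵥ e₁].det := by
    intro e
    -- Taking a basis vector for a leaves the index k' free in the first column.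
    have := sum_sum_mul_det_fin_three (Pi.single k' 1) (b s) (c s) e e₀ e₁
    rw [Finset.sum_eq_single k' (fun i _ hi => by simp [hi]) (by simp)] at this
    simpa using this
  rw [← hrow, ← hrow, Finset.mul_sum, Finset.mul_sum, ← Finset.sum_sub_distrib]
  exact Finset.sum_congr rfl fun i _ => by ring
end

/-! ### Calculus of coordinate derivatives. -/

section PartialDerivative

variable {F : Type*} [NormedAddCommGroup F] [NormedSpace ℝ F] {U : Set (Euc 2)} {u : Euc 2}

theorem ContDiffOn.pd {f : Euc 2 → F} (hf : ContDiffOn ℝ ∞ f U) (hU : IsOpen U) (a : Fin 2) :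
    ContDiffOn ℝ ∞ (pd a f) U :=
  (hf.fderiv_of_isOpen hU (by simp)).clm_apply contDiffOn_const

theorem ContDiffOn.differentiableAt_of_isOpen {f : Euc 2 → F} (hf : ContDiffOn ℝ ∞ f U)
    (hU : IsOpen U) (hu : u ∈ U) : DifferentiableAt ℝ f u :=
  (hf.contDiffAt (hU.mem_nhds hu)).differentiableAt (by simp)

theorem pd_congr_of_isOpen {f g : Euc 2 → F} (hU : IsOpen U) (hu : u ∈ U)
    (h : ∀ v ∈ U, f v = g v) (a : Fin 2) : pd a f u = pd a g u := by
  unfold pd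
  rw [Filter.EventuallyEq.fderiv_eq (Filter.eventually_of_mem (hU.mem_nhds hu) h)]

theorem pd_comm {f : Euc 2 → F} (hf : ContDiffOn ℝ ∞ f U) (hU : IsOpen U) (hu : u ∈ U)
    (a b : Fin 2) : pd a (pd b f) u = pd b (pd a f) u := by
  have hd : DifferentiableAt ℝ (fderiv ℝ f) u :=
    (hf.fderiv_of_isOpen (m := ∞) hU (by simp)).differentiableAt_of_isOpen hU hu
  have h : ∀ a b : Fin 2, pd a (pd b f) u =
      fderiv ℝ (fderiv ℝ f) u (EuclideanSpace.single a 1) (EuclideanSpace.single b 1) := by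
    intro a b
    unfold pd
    rw [fderiv_clm_apply hd (differentiableAt_const _)]
    simp
  rw [h, h]
  exact ((hf.contDiffAt (hU.mem_nhds hu)).isSymmSndFDerivAt
    (by simpa using (WithTop.coe_le_coe.2 (le_top : (2 : ℕ∞) ≤ ⊤)))) _ _

theorem pd_mul {f g : Euc 2 → ℝ} (hf : DifferentiableAt ℝ f u) (hg : DifferentiableAt ℝ g u)
    (a : Fin 2) : pd a (fun v => f v * g v) u = pd a f u * g u + f u * pd a g u := by
  unfold pd
  rw [fderiv_fun_mul hf hg]
  simp
  ring

theorem pd_add {f g : Euc 2 → ℝ} (hf : DifferentiableAt ℝ f u) (hg : DifferentiableAt ℝ g u)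
    (a : Fin 2) : pd a (fun v => f v + g v) u = pd a f u + pd a g u := by
  unfold pd
  rw [fderiv_fun_add hf hg]
  simp

theorem pd_sub {f g : Euc 2 → ℝ} (hf : DifferentiableAt ℝ f u) (hg : DifferentiableAt ℝ g u)
    (a : Fin 2) : pd a (fun v => f v - g v) u = pd a f u - pd a g u := by
  unfold pd
  rw [fderiv_fun_sub hf hg]
  simp

theorem pd_one_div {f : Euc 2 → ℝ} (hf : DifferentiableAt ℝ f u) (h0 : f u ≠ 0) (a : Fin 2) :
    pd a (fun v => 1 / f v) u = -(pd a f u / f u ^ 2) := by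
  unfold pd
  have h := ((hasDerivAt_inv h0).comp_hasFDerivAt u hf.hasFDerivAt).fderiv
  simp only [one_div]
  refine (congrArg (fun L : Euc 2 →L[ℝ] ℝ => L (EuclideanSpace.single a 1)) h).trans ?_
  simp
  ring

theorem pd_inner {E : Type*} [NormedAddCommGroup E] [InnerProductSpace ℝ E] {f g : Euc 2 → E}
    (hf : DifferentiableAt ℝ f u) (hg : DifferentiableAt ℝ g u) (a : Fin 2) :
    pd a (fun v => inner ℝ (f v) (g v)) u =
      inner ℝ (pd a f u) (g u) + inner ℝ (f u) (pd a g u) := by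
  unfold pd
  rw [fderiv_inner_apply ℝ hf hg]
  ring

theorem pd_apply {n : ℕ} {f : Euc 2 → Euc n} (hf : DifferentiableAt ℝ f u) (i : Fin n)
    (a : Fin 2) : pd a (fun v => f v i) u = pd a f u i := by
  unfold pd
  have h := ((EuclideanSpace.proj i : Euc n →L[ℝ] ℝ).hasFDerivAt.comp u hf.hasFDerivAt).fderiv
  exact congrArg (fun L : Euc 2 →L[ℝ] ℝ => L (EuclideanSpace.single a 1)) h

end PartialDerivative

/-! ### Christoffel symbols and the Gauss equation. -/

section Curvature

variable {n : ℕ} {X : Euc 2 → Euc n} {U : Set (Euc 2)} {u : Euc 2}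

theorem inducedMetric_comm (a b : Fin 2) : inducedMetric X u a b = inducedMetric X u b a :=
  real_inner_comm _ _

theorem contDiffOn_inducedMetric (hX : ContDiffOn ℝ ∞ X U) (hU : IsOpen U) (a b : Fin 2) :
    ContDiffOn ℝ ∞ (fun v => inducedMetric X v a b) U :=
  (hX.pd hU a).inner ℝ (hX.pd hU b)

theorem pd_inducedMetric (hX : ContDiffOn ℝ ∞ X U) (hU : IsOpen U) (hu : u ∈ U)
    (a b c : Fin 2) : pd c (fun v => inducedMetric X v a b) u =
      inner ℝ (pd c (pd a X) u) (pd b X u) + inner ℝ (pd a X u) (pd c (pd b X) u) :=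
  pd_inner ((hX.pd hU a).differentiableAt_of_isOpen hU hu)
    ((hX.pd hU b).differentiableAt_of_isOpen hU hu) c

/-- Once the metric derivatives are expanded, symmetry of z_ab cancels all terms but 2⟨e_d, z_ab⟩.
-/
theorem christoffel_eq (hX : ContDiffOn ℝ ∞ X U) (hU : IsOpen U) (hu : u ∈ U)
    (c a b : Fin 2) : christoffel X c a b u =
      ∑ d, (inducedMetric X u)⁻¹ c d * inner ℝ (pd d X u) (pd a (pd b X) u) := by
  unfold christoffel
  rw [Finset.mul_sum]
  refine Finset.sum_congr rfl fun d _ => ?_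
  rw [pd_inducedMetric hX hU hu, pd_inducedMetric hX hU hu, pd_inducedMetric hX hU hu,
    pd_comm hX hU hu b a, pd_comm hX hU hu d a, pd_comm hX hU hu d b,
    real_inner_comm (pd b X u), real_inner_comm (pd a X u) (pd b (pd d X) u)]
  ring

theorem sum_inducedMetric_mul_christoffel (hX : ContDiffOn ℝ ∞ X U) (hU : IsOpen U) (hu : u ∈ U)
    (hdet : (inducedMetric X u).det ≠ 0) (c a b : Fin 2) :
    ∑ d, inducedMetric X u d c * christoffel X d a b u =
      inner ℝ (pd c X u) (pd a (pd b X) u) := by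
  simp_rw [christoffel_eq hX hU hu, Finset.mul_sum, inducedMetric_comm _ c, ← mul_assoc]
  rw [Finset.sum_comm]
  simp_rw [← Finset.sum_mul, ← Matrix.mul_apply]
  rw [Matrix.mul_nonsing_inv _ (isUnit_iff_ne_zero.mpr hdet)]
  simp [Matrix.one_apply]

theorem inducedMetric_det : (inducedMetric X u).det =
    inner ℝ (pd 0 X u) (pd 0 X u) * inner ℝ (pd 1 X u) (pd 1 X u) -
      inner ℝ (pd 0 X u) (pd 1 X u) * inner ℝ (pd 0 X u) (pd 1 X u) := by
  rw [Matrix.det_fin_two, inducedMetric_comm 1 0]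
  rfl

/-- Valid even for a degenerate metric, where both sides are 0, so it can be rewritten inside
functions of the base point. -/
theorem inv_inducedMetric : (inducedMetric X u)⁻¹ = (1 / (inducedMetric X u).det) •
    !![inner ℝ (pd 1 X u) (pd 1 X u), -inner ℝ (pd 0 X u) (pd 1 X u);
      -inner ℝ (pd 0 X u) (pd 1 X u), inner ℝ (pd 0 X u) (pd 0 X u)] := by
  rw [Matrix.inv_def, Matrix.adjugate_fin_two, inducedMetric_comm 1 0, Ring.inverse_eq_inv',
    one_div]
  rfl

theorem differentiableAt_christoffel (hX : ContDiffOn ℝ ∞ X U) (hU : IsOpen U) (hu : u ∈ U)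
    (hdet : (inducedMetric X u).det ≠ 0) (c a b : Fin 2) :
    DifferentiableAt ℝ (christoffel X c a b) u := by
  have hg : ∀ d d', DifferentiableAt ℝ (fun v => inner ℝ (pd d X v) (pd d' X v)) u := fun d d' =>
    (contDiffOn_inducedMetric hX hU d d').differentiableAt_of_isOpen hU hu
  have hγ : ∀ d, DifferentiableAt ℝ (fun v => inner ℝ (pd d X v) (pd a (pd b X) v)) u := fun d =>
    ((hX.pd hU d).inner ℝ ((hX.pd hU b).pd hU a)).differentiableAt_of_isOpen hU hu
  have hD : DifferentiableAt ℝ (fun v => (inducedMetric X v).det) u := by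
    simp_rw [inducedMetric_det]
    exact ((hg 0 0).mul (hg 1 1)).sub ((hg 0 1).mul (hg 0 1))
  have hinv : ∀ d, DifferentiableAt ℝ (fun v => (inducedMetric X v)⁻¹ c d) u := by
    intro d
    simp_rw [inv_inducedMetric, Matrix.smul_apply, smul_eq_mul]
    have hD' : DifferentiableAt ℝ (fun v => 1 / (inducedMetric X v).det) u :=
      by
      simpa only [one_div] using hD.fun_inv hdet
    refine hD'.mul ?_
    fin_cases c <;> fin_cases d
    · exact hg 1 1
    · exact (hg 0 1).neg
    · exact (hg 0 1).neg
    · exact hg 0 0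
  have hsum : DifferentiableAt ℝ (fun v =>
      ∑ d, (inducedMetric X v)⁻¹ c d * inner ℝ (pd d X v) (pd a (pd b X) v)) u :=
    DifferentiableAt.fun_sum fun d _ => (hinv d).mul (hγ d)
  exact hsum.congr_of_eventuallyEq
    (Filter.eventually_of_mem (hU.mem_nhds hu) fun v hv => christoffel_eq hX hU hv c a b)

/-- Differentiating the lowered identity g_{de} Γ^d_{bc} = ⟨e_e, z_bc⟩ avoids derivatives of the
inverse metric. -/
theorem sum_pd_christoffel_mul_inducedMetric (hX : ContDiffOn ℝ ∞ X U) (hU : IsOpen U)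
    (hdet : ∀ v ∈ U, (inducedMetric X v).det ≠ 0) (hu : u ∈ U) (a b c e : Fin 2) :
    ∑ d, pd a (christoffel X d b c) u * inducedMetric X u d e =
      inner ℝ (pd a (pd e X) u) (pd b (pd c X) u) +
        inner ℝ (pd e X u) (pd a (pd b (pd c X)) u) -
      ∑ d, (inner ℝ (pd a (pd d X) u) (pd e X u) + inner ℝ (pd d X u) (pd a (pd e X) u)) *
        christoffel X d b c u := by
  have hg : ∀ d d', DifferentiableAt ℝ (fun v => inducedMetric X v d d') u := fun d d' =>
    (contDiffOn_inducedMetric hX hU d d').differentiableAt_of_isOpen hU hu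
  have hΓ := fun d => differentiableAt_christoffel hX hU hu (hdet u hu) d b c
  have h := pd_congr_of_isOpen hU hu
    (fun v hv => sum_inducedMetric_mul_christoffel hX hU hv (hdet v hv) e b c) a
  rw [pd_inner ((hX.pd hU e).differentiableAt_of_isOpen hU hu)
    (((hX.pd hU c).pd hU b).differentiableAt_of_isOpen hU hu)] at h
  simp_rw [Fin.sum_univ_two] at h ⊢
  have hgΓ : ∀ d, DifferentiableAt ℝ
      (fun v => inducedMetric X v d e * christoffel X d b c v) u := fun d => (hg d e).mul (hΓ d)
  rw [pd_add (hgΓ 0) (hgΓ 1), pd_mul (hg 0 e) (hΓ 0),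
    pd_mul (hg 1 e) (hΓ 1), pd_inducedMetric hX hU hu, pd_inducedMetric hX hU hu] at h
  linarith

/-- The Gauss equation of a surface in Euclidean space, in local coordinates. -/
theorem gaussianCurvature_eq (hX : ContDiffOn ℝ ∞ X U) (hU : IsOpen U)
    (hdet : ∀ v ∈ U, (inducedMetric X v).det ≠ 0) (hu : u ∈ U) :
    gaussianCurvature X u =
      (inner ℝ (pd 0 (pd 0 X) u) (pd 1 (pd 1 X) u) -
        inner ℝ (pd 0 (pd 1 X) u) (pd 0 (pd 1 X) u) -
        ∑ e, (inner ℝ (pd e X u) (pd 0 (pd 0 X) u) * christoffel X e 1 1 u -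
          inner ℝ (pd e X u) (pd 0 (pd 1 X) u) * christoffel X e 0 1 u)) /
        (inducedMetric X u).det := by
  unfold gaussianCurvature
  congr 1
  have h₁ := sum_pd_christoffel_mul_inducedMetric hX hU hdet hu 0 1 1 0
  have h₂ := sum_pd_christoffel_mul_inducedMetric hX hU hdet hu 1 0 1 0
  have h₃ := fun a e => sum_inducedMetric_mul_christoffel hX hU hu (hdet u hu) 0 a e
  -- The third derivatives of X in `h₁` and `h₂` now agree and cancel in the difference.
  rw [pd_comm (hX.pd hU 1) hU hu 0 1] at h₁
  have h00 := h₃ 0 0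
  have h01 := h₃ 0 1
  have h10 := h₃ 1 0
  have h11 := h₃ 1 1
  rw [pd_comm hX hU hu 1 0] at h10
  simp only [riemannCurvature, Fin.sum_univ_two] at *
  simp only [pd_comm hX hU hu 1 0] at h₂
  rw [real_inner_comm (pd 0 X u)] at h₁ h₂
  rw [real_inner_comm (pd 0 X u) (pd 0 (pd 1 X) u)] at h₁
  rw [real_inner_comm (pd 0 X u) (pd 1 (pd 1 X) u)] at h₂
  linear_combination h₁ - h₂ + christoffel X 0 1 1 u * h00 + christoffel X 1 1 1 u * h01
    - christoffel X 0 0 1 u * h10 - christoffel X 1 0 1 u * h11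

end Curvature

/-! ### Evaluation of the Gram determinant sums. -/

section Contraction

variable {n : ℕ}

theorem dotProduct_ofLp_ofLp (v w : Euc n) : v.ofLp ⬝ᵥ w.ofLp = inner ℝ v w := by
  rw [EuclideanSpace.inner_eq_star_dotProduct, dotProduct_comm]
  simp

/-- The right side is -2g times the numerator of the Gauss equation, with g⁻¹ written out by
cofactors; r₀ and r₁ have disappeared. -/
theorem sum_gram_det_eq (e₀ e₁ z₀₀ z₀₁ z₁₁ : Euc n) (r₀ r₁ : ℝ) (a b c : Fin 4 → Euc n)
    (ha : a = ![e₀, e₀, -e₁, -e₁]) (hb : b = ![z₀₁, e₀, z₀₀, e₀])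
    (hc : c = ![e₁, z₁₁ - r₁ • e₁, e₁, z₀₁ - r₀ • e₁]) :
    ∑ s, ∑ t, !![inner ℝ (a t) (a s), inner ℝ (a t) (b t), inner ℝ (a t) (c t);
        inner ℝ (b s) (a s), inner ℝ (b s) (b t), inner ℝ (b s) (c t);
        inner ℝ (c s) (a s), inner ℝ (c s) (b t), inner ℝ (c s) (c t)].det =
      -2 * ((inner ℝ e₀ e₀ * inner ℝ e₁ e₁ - inner ℝ e₀ e₁ * inner ℝ e₀ e₁) *
          (inner ℝ z₀₀ z₁₁ - inner ℝ z₀₁ z₀₁) -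
        (inner ℝ e₀ z₀₀ * (inner ℝ e₁ e₁ * inner ℝ e₀ z₁₁ - inner ℝ e₀ e₁ * inner ℝ e₁ z₁₁) +
          inner ℝ e₁ z₀₀ * (inner ℝ e₀ e₀ * inner ℝ e₁ z₁₁ - inner ℝ e₀ e₁ * inner ℝ e₀ z₁₁) -
          inner ℝ e₀ z₀₁ * (inner ℝ e₁ e₁ * inner ℝ e₀ z₀₁ - inner ℝ e₀ e₁ * inner ℝ e₁ z₀₁) -
          inner ℝ e₁ z₀₁ *
            (inner ℝ e₀ e₀ * inner ℝ e₁ z₀₁ - inner ℝ e₀ e₁ * inner ℝ e₀ z₀₁))) := by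
  subst ha hb hc
  simp only [Fin.sum_univ_four, det_of_fin_three, Matrix.cons_val, inner_sub_left,
    inner_sub_right, real_inner_smul_left, real_inner_smul_right, inner_neg_left,
    inner_neg_right]
  simp only [real_inner_comm e₀ e₁, real_inner_comm e₀ z₀₀, real_inner_comm e₀ z₀₁,
    real_inner_comm e₀ z₁₁, real_inner_comm e₁ z₀₀, real_inner_comm e₁ z₀₁,
    real_inner_comm e₁ z₁₁, real_inner_comm z₀₀ z₀₁, real_inner_comm z₀₀ z₁₁,
    real_inner_comm z₀₁ z₁₁]
  ring

/-- The right side is g² times the normal part of g^{ab} z_ab, with denominators cleared. -/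
theorem sum_bordered_gram_det_eq (e₀ e₁ z₀₀ z₀₁ z₁₁ : Euc n) (r₀ r₁ : ℝ) (a b c : Fin 4 → Euc n)
    (ha : a = ![e₀, e₀, -e₁, -e₁]) (hb : b = ![z₀₁, e₀, z₀₀, e₀])
    (hc : c = ![e₁, z₁₁ - r₁ • e₁, e₁, z₀₁ - r₀ • e₁]) (k' : Fin n) :
    ∑ s, (inner ℝ e₁ (a s) *
          !![e₀ k', inner ℝ e₀ e₀, inner ℝ e₀ e₁; b s k', inner ℝ (b s) e₀, inner ℝ (b s) e₁;
            c s k', inner ℝ (c s) e₀, inner ℝ (c s) e₁].det -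
        inner ℝ e₀ (a s) *
          !![e₁ k', inner ℝ e₁ e₀, inner ℝ e₁ e₁; b s k', inner ℝ (b s) e₀, inner ℝ (b s) e₁;
            c s k', inner ℝ (c s) e₀, inner ℝ (c s) e₁].det) =
      (inner ℝ e₀ e₀ * inner ℝ e₁ e₁ - inner ℝ e₀ e₁ * inner ℝ e₀ e₁) *
        (inner ℝ e₁ e₁ * z₀₀ k' - 2 * inner ℝ e₀ e₁ * z₀₁ k' + inner ℝ e₀ e₀ * z₁₁ k') -
      ((inner ℝ e₁ e₁ * (inner ℝ e₁ e₁ * inner ℝ e₀ z₀₀ - inner ℝ e₀ e₁ * inner ℝ e₁ z₀₀) -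
        2 * inner ℝ e₀ e₁ * (inner ℝ e₁ e₁ * inner ℝ e₀ z₀₁ - inner ℝ e₀ e₁ * inner ℝ e₁ z₀₁) +
        inner ℝ e₀ e₀ * (inner ℝ e₁ e₁ * inner ℝ e₀ z₁₁ - inner ℝ e₀ e₁ * inner ℝ e₁ z₁₁)) *
          e₀ k' +
       (inner ℝ e₁ e₁ * (inner ℝ e₀ e₀ * inner ℝ e₁ z₀₀ - inner ℝ e₀ e₁ * inner ℝ e₀ z₀₀) -
        2 * inner ℝ e₀ e₁ * (inner ℝ e₀ e₀ * inner ℝ e₁ z₀₁ - inner ℝ e₀ e₁ * inner ℝ e₀ z₀₁) +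
        inner ℝ e₀ e₀ * (inner ℝ e₀ e₀ * inner ℝ e₁ z₁₁ - inner ℝ e₀ e₁ * inner ℝ e₀ z₁₁)) *
          e₁ k') := by
  subst ha hb hc
  simp only [Fin.sum_univ_four, det_of_fin_three, Matrix.cons_val, inner_sub_left,
    real_inner_smul_left, inner_neg_right, PiLp.sub_apply, PiLp.smul_apply, smul_eq_mul]
  simp only [real_inner_comm e₀ e₁, real_inner_comm e₀ z₀₀, real_inner_comm e₀ z₀₁,
    real_inner_comm e₀ z₁₁, real_inner_comm e₁ z₀₀, real_inner_comm e₁ z₀₁,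
    real_inner_comm e₁ z₁₁]
  ring

end Contraction

/-! ### Single and nested brackets of the coordinate functions. -/

section Bracket

variable {n : ℕ} {X : Euc 2 → Euc n} {ρ : Euc 2 → ℝ} {U : Set (Euc 2)} {u : Euc 2}

theorem poissonBracket_coord (hX : ContDiffOn ℝ ∞ X U) (hU : IsOpen U) (hu : u ∈ U)
    (k l : Fin n) : poissonBracket ρ (fun v => X v k) (fun v => X v l) u =
      1 / ρ u * (pd 0 X u k * pd 1 X u l - pd 0 X u l * pd 1 X u k) := by
  have hd := hX.differentiableAt_of_isOpen hU hu
  simp only [poissonBracket, pd_apply hd]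
  ring

theorem pd_poissonBracket_coord (hX : ContDiffOn ℝ ∞ X U) (hρ : ContDiffOn ℝ ∞ ρ U)
    (hU : IsOpen U) (hu : u ∈ U) (h0 : ρ u ≠ 0) (k l : Fin n) (a : Fin 2) :
    pd a (poissonBracket ρ (fun v => X v k) (fun v => X v l)) u =
      1 / ρ u * (pd a (pd 0 X) u k * pd 1 X u l + pd 0 X u k * pd a (pd 1 X) u l -
        pd a (pd 0 X) u l * pd 1 X u k - pd 0 X u l * pd a (pd 1 X) u k) -
      pd a ρ u / ρ u ^ 2 * (pd 0 X u k * pd 1 X u l - pd 0 X u l * pd 1 X u k) := by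
  have hρd := hρ.differentiableAt_of_isOpen hU hu
  have he : ∀ b, DifferentiableAt ℝ (pd b X) u := fun b =>
    (hX.pd hU b).differentiableAt_of_isOpen hU hu
  have hc : ∀ (b : Fin 2) (i : Fin n), DifferentiableAt ℝ (fun v => pd b X v i) u := fun b i =>
    differentiableAt_euclidean.mp (he b) i
  have hρi : DifferentiableAt ℝ (fun v => 1 / ρ v) u := by
    simpa only [one_div] using hρd.fun_inv h0
  have hm : ∀ i j : Fin n, DifferentiableAt ℝ (fun v => pd 0 X v i * pd 1 X v j) u :=
    fun i j => (hc 0 i).mul (hc 1 j)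
  rw [pd_congr_of_isOpen hU hu (fun v hv => poissonBracket_coord hX hU hv k l),
    pd_mul hρi ((hm k l).fun_sub (hm l k)), pd_sub (hm k l) (hm l k), pd_mul (hc 0 k) (hc 1 l),
    pd_mul (hc 0 l) (hc 1 k), pd_one_div hρd h0, pd_apply (he 0), pd_apply (he 0),
    pd_apply (he 1), pd_apply (he 1)]
  ring

theorem poissonBracket_poissonBracket_coord (hX : ContDiffOn ℝ ∞ X U) (hρ : ContDiffOn ℝ ∞ ρ U)
    (hU : IsOpen U) (hu : u ∈ U) (h0 : ρ u ≠ 0) (a b c : Fin 4 → Euc n)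
    (ha : a = ![pd 0 X u, pd 0 X u, -pd 1 X u, -pd 1 X u])
    (hb : b = ![pd 0 (pd 1 X) u, pd 0 X u, pd 0 (pd 0 X) u, pd 0 X u])
    (hc : c = ![pd 1 X u, pd 1 (pd 1 X) u - (pd 1 ρ u / ρ u) • pd 1 X u, pd 1 X u,
      pd 0 (pd 1 X) u - (pd 0 ρ u / ρ u) • pd 1 X u]) (i k l : Fin n) :
    poissonBracket ρ (fun v => X v i)
        (poissonBracket ρ (fun v => X v k) (fun v => X v l)) u =
      1 / ρ u ^ 2 * ∑ s, a s i * (b s k * c s l - b s l * c s k) := by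
  have hd := hX.differentiableAt_of_isOpen hU hu
  subst ha hb hc
  rw [poissonBracket, pd_poissonBracket_coord hX hρ hU hu h0,
    pd_poissonBracket_coord hX hρ hU hu h0, pd_apply hd, pd_apply hd, pd_comm hX hU hu 1 0]
  simp only [Fin.sum_univ_four, Matrix.cons_val, PiLp.sub_apply, PiLp.smul_apply,
    PiLp.neg_apply, smul_eq_mul]
  field_simp
  ring

end Bracket

/-! ### Normal part of the second derivatives and the mean curvature vector. -/

section MeanCurvature

variable {n : ℕ} {X : Euc 2 → Euc n} {U : Set (Euc 2)} {u : Euc 2}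

/-- The candidate is orthogonal to each e_c by the lowered Christoffel identity, and it differs from
z_ab by a tangent vector. -/
theorem secondFundamentalForm_eq (hX : ContDiffOn ℝ ∞ X U) (hU : IsOpen U) (hu : u ∈ U)
    (hdet : (inducedMetric X u).det ≠ 0) (a b : Fin 2) :
    (secondFundamentalForm X a b u : Euc n) =
      pd a (pd b X) u - ∑ d, christoffel X d a b u • pd d X u := by
  have hmem : ∀ d, pd d X u ∈ Submodule.span ℝ (Set.range fun a : Fin 2 => pd a X u) :=
    fun d => Submodule.subset_span ⟨d, rfl⟩
  refine Submodule.eq_starProjection_of_mem_orthogonal (K := normalSpace X u) ?_ ?_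
  · refine (Submodule.mem_orthogonal _ _).2 fun w hw => ?_
    induction hw using Submodule.span_induction with
    | mem w hw =>
      obtain ⟨c, rfl⟩ := hw
      simp only [inner_sub_right, inner_sum, real_inner_smul_right]
      rw [sub_eq_zero, ← sum_inducedMetric_mul_christoffel hX hU hu hdet c a b]
      refine Finset.sum_congr rfl fun d _ => ?_
      rw [mul_comm, inducedMetric_comm d c]
      rfl
    | zero => exact inner_zero_left _
    | add x y _ _ hx hy => rw [inner_add_left, hx, hy, add_zero]
    | smul r x _ hx => rw [real_inner_smul_left, hx, mul_zero]
  · rw [sub_sub_cancel]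
    exact Submodule.le_orthogonal_orthogonal _
      (Submodule.sum_mem _ fun d _ => Submodule.smul_mem _ _ (hmem d))

/-- Expanding α_ab in the orthonormal basis removes the basis: H = ½ g^{ab} α_ba. -/
theorem meanCurvatureVector_eq {p : ℕ} (N : OrthonormalBasis (Fin p) ℝ (normalSpace X u)) :
    meanCurvatureVector X N =
      (1 / 2 : ℝ) • ∑ a, ∑ b,
        (inducedMetric X u)⁻¹ a b • (secondFundamentalForm X b a u : Euc n) := by
  unfold meanCurvatureVector
  congr 1
  have h : ∀ A, (weingarten X (N A)).trace • (N A : Euc n) = ∑ a, ∑ b,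
      (inducedMetric X u)⁻¹ a b • (inner ℝ (N A) (secondFundamentalForm X b a u) •
        (N A : Euc n)) := by
    intro A
    simp only [weingarten, Matrix.trace, Matrix.diag_apply, Matrix.mul_apply, Matrix.of_apply,
      Finset.sum_smul, smul_smul, real_inner_comm (N A)]
  simp_rw [h]
  rw [Finset.sum_comm]
  refine Finset.sum_congr rfl fun a _ => ?_
  rw [Finset.sum_comm]
  refine Finset.sum_congr rfl fun b _ => ?_
  rw [← Finset.smul_sum]
  congr 1
  have := congrArg (normalSpace X u).subtype (N.sum_repr' (secondFundamentalForm X b a u))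
  simpa using this

end MeanCurvature

/-! ### The two formulas on an open coordinate domain. -/

section Formulas

variable {q : ℕ} {X : Euc 2 → Euc (q + 3)} {ρ : Euc 2 → ℝ} {U : Set (Euc 2)} {u : Euc 2}

theorem gaussianCurvature_eq_sum_poissonBracket (hX : ContDiffOn ℝ ∞ X U)
    (hρ : ContDiffOn ℝ ∞ ρ U) (hU : IsOpen U) (hdet : ∀ v ∈ U, (inducedMetric X v).det ≠ 0)
    (hu : u ∈ U) (h0 : ρ u ≠ 0) :
    gaussianCurvature X u =
      -((ρ u) ^ 4 / (8 * (inducedMetric X u).det ^ 2 * (q.factorial : ℝ))) *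
        ∑ i, ∑ j, ∑ k, ∑ l, ∑ m, ∑ n, ∑ I : Fin q → Fin (q + 3),
          leviCivita₃ j k l I * leviCivita₃ i m n I *
            poissonBracket ρ (fun v => X v i)
              (poissonBracket ρ (fun v => X v k) (fun v => X v l)) u *
            poissonBracket ρ (fun v => X v j)
              (poissonBracket ρ (fun v => X v m) (fun v => X v n)) u := by
  obtain ⟨a, ha⟩ : ∃ a, a = ![pd 0 X u, pd 0 X u, -pd 1 X u, -pd 1 X u] := ⟨_, rfl⟩
  obtain ⟨b, hb⟩ : ∃ b, b = ![pd 0 (pd 1 X) u, pd 0 X u, pd 0 (pd 0 X) u, pd 0 X u] := ⟨_, rfl⟩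
  obtain ⟨c, hc⟩ : ∃ c, c = ![pd 1 X u, pd 1 (pd 1 X) u - (pd 1 ρ u / ρ u) • pd 1 X u, pd 1 X u,
      pd 0 (pd 1 X) u - (pd 0 ρ u / ρ u) • pd 1 X u] := ⟨_, rfl⟩
  have hterm : ∀ i j k l m n, ∑ I : Fin q → Fin (q + 3),
      leviCivita₃ j k l I * leviCivita₃ i m n I *
        poissonBracket ρ (fun v => X v i)
          (poissonBracket ρ (fun v => X v k) (fun v => X v l)) u *
        poissonBracket ρ (fun v => X v j)
          (poissonBracket ρ (fun v => X v m) (fun v => X v n)) u =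
      q.factorial * (1 / ρ u ^ 2) ^ 2 * (generalizedKronecker ![j, k, l] ![i, m, n] *
        (∑ s, (a s).ofLp i * ((b s).ofLp k * (c s).ofLp l - (b s).ofLp l * (c s).ofLp k)) *
        (∑ t, (a t).ofLp j * ((b t).ofLp m * (c t).ofLp n - (b t).ofLp n * (c t).ofLp m))) := by
    intro i j k l m n
    rw [← Finset.sum_mul, ← Finset.sum_mul, sum_leviCivita₃_mul_leviCivita₃,
      poissonBracket_poissonBracket_coord hX hρ hU hu h0 a b c ha hb hc,
      poissonBracket_poissonBracket_coord hX hρ hU hu h0 a b c ha hb hc]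
    ring
  simp_rw [hterm, ← Finset.mul_sum]
  rw [sum_generalizedKronecker_mul_crossed (fun s => (a s).ofLp) (fun s => (b s).ofLp)
    (fun s => (c s).ofLp)]
  simp_rw [dotProduct_ofLp_ofLp]
  rw [sum_gram_det_eq _ _ _ _ _ _ _ a b c ha hb hc, gaussianCurvature_eq hX hU hdet hu]
  simp only [christoffel_eq hX hU hu, Fin.sum_univ_two, inv_inducedMetric, Matrix.smul_apply,
    Matrix.of_apply, Matrix.cons_val', Matrix.cons_val, smul_eq_mul]
  have hD := hdet u hu
  have hq : (q.factorial : ℝ) ≠ 0 := Nat.cast_ne_zero.mpr q.factorial_ne_zero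
  -- Folding the determinant back lets `field_simp` clear it as a single nonzero quantity.
  rw [← inducedMetric_det]
  field_simp
  ring

theorem meanCurvatureVector_eq_sum_poissonBracket (hX : ContDiffOn ℝ ∞ X U)
    (hρ : ContDiffOn ℝ ∞ ρ U) (hU : IsOpen U) (hu : u ∈ U)
    (hdet : (inducedMetric X u).det ≠ 0) (h0 : ρ u ≠ 0) {p : ℕ}
    (N : OrthonormalBasis (Fin p) ℝ (normalSpace X u)) :
    meanCurvatureVector X N =
      ((ρ u) ^ 4 / (8 * (inducedMetric X u).det ^ 2 * (q.factorial : ℝ))) •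
        ∑ k', (∑ i, ∑ j, ∑ k, ∑ l, ∑ m, ∑ n, ∑ I : Fin q → Fin (q + 3),
          leviCivita₃ i k l I * leviCivita₃ k' m n I *
            poissonBracket ρ (fun v => X v i) (fun v => X v j) u *
            poissonBracket ρ (fun v => X v j)
              (poissonBracket ρ (fun v => X v k) (fun v => X v l)) u *
            poissonBracket ρ (fun v => X v m) (fun v => X v n) u) •
          EuclideanSpace.single k' (1 : ℝ) := by
  obtain ⟨a, ha⟩ : ∃ a, a = ![pd 0 X u, pd 0 X u, -pd 1 X u, -pd 1 X u] := ⟨_, rfl⟩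
  obtain ⟨b, hb⟩ : ∃ b, b = ![pd 0 (pd 1 X) u, pd 0 X u, pd 0 (pd 0 X) u, pd 0 X u] := ⟨_, rfl⟩
  obtain ⟨c, hc⟩ : ∃ c, c = ![pd 1 X u, pd 1 (pd 1 X) u - (pd 1 ρ u / ρ u) • pd 1 X u, pd 1 X u,
      pd 0 (pd 1 X) u - (pd 0 ρ u / ρ u) • pd 1 X u] := ⟨_, rfl⟩
  have hterm : ∀ k' i j k l m n, ∑ I : Fin q → Fin (q + 3),
      leviCivita₃ i k l I * leviCivita₃ k' m n I *
        poissonBracket ρ (fun v => X v i) (fun v => X v j) u *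
        poissonBracket ρ (fun v => X v j)
          (poissonBracket ρ (fun v => X v k) (fun v => X v l)) u *
        poissonBracket ρ (fun v => X v m) (fun v => X v n) u =
      q.factorial * (1 / ρ u ^ 4) * (generalizedKronecker ![i, k, l] ![k', m, n] *
        ((pd 0 X u).ofLp i * (pd 1 X u).ofLp j - (pd 0 X u).ofLp j * (pd 1 X u).ofLp i) *
        (∑ s, (a s).ofLp j * ((b s).ofLp k * (c s).ofLp l - (b s).ofLp l * (c s).ofLp k)) *
        ((pd 0 X u).ofLp m * (pd 1 X u).ofLp n - (pd 0 X u).ofLp n * (pd 1 X u).ofLp m)) := by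
    intro k' i j k l m n
    rw [← Finset.sum_mul, ← Finset.sum_mul, ← Finset.sum_mul, sum_leviCivita₃_mul_leviCivita₃,
      poissonBracket_poissonBracket_coord hX hρ hU hu h0 a b c ha hb hc,
      poissonBracket_coord hX hU hu, poissonBracket_coord hX hU hu]
    field_simp
  simp_rw [hterm, ← Finset.mul_sum]
  have hsum := fun k' => sum_generalizedKronecker_mul_bivector (pd 0 X u).ofLp (pd 1 X u).ofLp
    (fun s => (a s).ofLp) (fun s => (b s).ofLp) (fun s => (c s).ofLp) k'
  simp_rw [hsum, dotProduct_ofLp_ofLp]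
  simp_rw [sum_bordered_gram_det_eq _ _ _ _ _ _ _ a b c ha hb hc]
  have hq : (q.factorial : ℝ) ≠ 0 := Nat.cast_ne_zero.mpr q.factorial_ne_zero
  rw [meanCurvatureVector_eq]
  ext k'
  have hsingle : ∀ f : Fin (q + 3) → ℝ,
      (∑ k, f k • (EuclideanSpace.single k (1 : ℝ) : Euc (q + 3))).ofLp k' = f k' := by
    intro f
    simp [Finset.sum_apply, Pi.single_apply]
  rw [PiLp.smul_apply, PiLp.smul_apply, hsingle]
  simp only [secondFundamentalForm_eq hX hU hu hdet, christoffel_eq hX hU hu, Fin.sum_univ_two,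
    inv_inducedMetric, Matrix.smul_apply, Matrix.of_apply, Matrix.cons_val', Matrix.cons_val,
    smul_eq_mul, PiLp.add_apply, PiLp.sub_apply, PiLp.smul_apply, pd_comm hX hU hu 1 0]
  rw [← inducedMetric_det]
  field_simp
  ring

end Formulas

/-! ### From immersions of a manifold to coordinate patches. -/

section Immersion

theorem inducedMetric_det_ne_zero {n : ℕ} {X : Euc 2 → Euc n} {u : Euc 2}
    (h : Function.Injective (fderiv ℝ X u)) : (inducedMetric X u).det ≠ 0 := by
  intro hdet
  rw [inducedMetric_det] at hdet
  have h₀ : pd 0 X u ≠ 0 := by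
    intro h0
    have := h (h0.trans (map_zero _).symm)
    simpa using congrArg (fun v : Euc 2 => v 0) this
  set e₀ := pd 0 X u
  set e₁ := pd 1 X u
  -- The squared norm of this vector is |e₀|² g, so g = 0 would give a linear relation between e₀
  -- and e₁.
  have hz : inner ℝ e₀ e₀ • e₁ - inner ℝ e₀ e₁ • e₀ = 0 := by
    rw [← inner_self_eq_zero (𝕜 := ℝ)]
    simp only [inner_sub_left, inner_sub_right, real_inner_smul_left, real_inner_smul_right,
      real_inner_comm e₀ e₁]
    linear_combination inner ℝ e₀ e₀ * hdet
  have hL : fderiv ℝ X u (inner ℝ e₀ e₀ • EuclideanSpace.single 1 1 -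
      inner ℝ e₀ e₁ • EuclideanSpace.single 0 1) = fderiv ℝ X u 0 := by
    rw [map_sub, map_smul, map_smul, map_zero]
    exact hz
  have := congrArg (fun v : Euc 2 => v 1) (h hL)
  simp at this
  exact h₀ this

variable {n : ℕ} {S : Type*} [TopologicalSpace S] [ChartedSpace (Euc 2) S]
  {x : S → Euc n} {φ : OpenPartialHomeomorph S (Euc 2)}

theorem contDiffOn_comp_chart_symm (hx : ContMDiff (𝓡 2) (𝓡 n) ∞ x)
    (hφ : φ ∈ IsManifold.maximalAtlas (𝓡 2) ∞ S) :
    ContDiffOn ℝ ∞ (fun v => x (φ.symm v)) φ.target :=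
  (hx.comp_contMDiffOn (contMDiffOn_symm_of_mem_maximalAtlas hφ)).contDiffOn

/-- Near u the chart composed with its inverse is the identity, so the differential of the inverse
chart has a left inverse. -/
theorem injective_fderiv_comp_chart_symm (hx : ContMDiff (𝓡 2) (𝓡 n) ∞ x)
    (himm : ∀ s, Function.Injective (mfderiv (𝓡 2) (𝓡 n) x s))
    (hφ : φ ∈ IsManifold.maximalAtlas (𝓡 2) ∞ S) {u : Euc 2} (hu : u ∈ φ.target) :
    Function.Injective (fderiv ℝ (fun v => x (φ.symm v)) u) := by
  have hsymm : MDifferentiableAt (𝓡 2) (𝓡 2) φ.symm u :=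
    (contMDiffAt_symm_of_mem_maximalAtlas hφ hu).mdifferentiableAt (by simp)
  have hφ' : MDifferentiableAt (𝓡 2) (𝓡 2) φ (φ.symm u) :=
    (contMDiffAt_of_mem_maximalAtlas hφ (φ.map_target hu)).mdifferentiableAt (by simp)
  have hx' : MDifferentiableAt (𝓡 2) (𝓡 n) x (φ.symm u) :=
    (hx (φ.symm u)).mdifferentiableAt (by simp)
  have hcomp := mfderiv_comp u hx' hsymm
  have hid : mfderiv (𝓡 2) (𝓡 2) (φ ∘ φ.symm) u = ContinuousLinearMap.id ℝ _ := by
    rw [Filter.EventuallyEq.mfderiv_eq (f₁ := φ ∘ φ.symm) (f := id)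
      (Filter.eventually_of_mem (φ.open_target.mem_nhds hu) fun v hv => φ.right_inv hv)]
    exact mfderiv_id
  rw [mfderiv_comp u hφ' hsymm] at hid
  have hinj : Function.Injective (mfderiv (𝓡 2) (𝓡 2) φ.symm u) := by
    refine Function.LeftInverse.injective (g := mfderiv (𝓡 2) (𝓡 2) φ (φ.symm u)) fun v => ?_
    exact congrArg (fun L : Euc 2 →L[ℝ] Euc 2 => L v) hid
  have h : Function.Injective (mfderiv (𝓡 2) (𝓡 n) (x ∘ φ.symm) u) := by
    rw [hcomp]
    exact (himm _).comp hinj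
  rw [mfderiv_eq_fderiv] at h
  exact h

end Immersion

theorem mainTheorem4 (q : ℕ) {S : Type*} [TopologicalSpace S] [ChartedSpace (Euc 2) S]
    [IsManifold (𝓡 2) ∞ S] (x : S → Euc (q + 3))
    (hx : ContMDiff (𝓡 2) (𝓡 (q + 3)) ∞ x)
    (himm : ∀ s, Function.Injective (mfderiv (𝓡 2) (𝓡 (q + 3)) x s))
    (density : NonvanishingDensity S)
    (φ : OpenPartialHomeomorph S (Euc 2)) (hφ : φ ∈ IsManifold.maximalAtlas (𝓡 2) ∞ S)
    (X : Euc 2 → Euc (q + 3)) (hX : X = fun v => x (φ.symm v))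
    (ρ : Euc 2 → ℝ) (hρ : ρ = density.coord φ)
    (bracket : (Euc 2 → ℝ) → (Euc 2 → ℝ) → Euc 2 → ℝ) (hbracket : bracket = poissonBracket ρ)
    (c : Fin (q + 3) → Euc 2 → ℝ) (hc : c = fun i v => X v i)
    (u : Euc 2) (hu : u ∈ φ.target) :
    gaussianCurvature X u =
        -((ρ u) ^ 4 / (8 * (inducedMetric X u).det ^ 2 * (q.factorial : ℝ))) *
          ∑ i, ∑ j, ∑ k, ∑ l, ∑ m, ∑ n, ∑ I : Fin q → Fin (q + 3),
            leviCivita₃ j k l I * leviCivita₃ i m n I *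
              bracket (c i) (bracket (c k) (c l)) u *
              bracket (c j) (bracket (c m) (c n)) u ∧
      ∀ N : OrthonormalBasis (Fin (q + 1)) ℝ (normalSpace X u),
        meanCurvatureVector X N =
          ((ρ u) ^ 4 / (8 * (inducedMetric X u).det ^ 2 * (q.factorial : ℝ))) •
            ∑ k', (∑ i, ∑ j, ∑ k, ∑ l, ∑ m, ∑ n, ∑ I : Fin q → Fin (q + 3),
              leviCivita₃ i k l I * leviCivita₃ k' m n I *
                bracket (c i) (c j) u *
                bracket (c j) (bracket (c k) (c l)) u *
                bracket (c m) (c n) u) •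
              EuclideanSpace.single k' (1 : ℝ) := by
  subst hX hρ hbracket hc
  have hXs := contDiffOn_comp_chart_symm hx hφ
  have hρs := density.contDiffOn_coord φ hφ
  have hdet := fun v hv =>
    inducedMetric_det_ne_zero (injective_fderiv_comp_chart_symm hx himm hφ (u := v) hv)
  have h0 := density.coord_ne_zero φ hφ u hu
  exact ⟨gaussianCurvature_eq_sum_poissonBracket hXs hρs φ.open_target hdet hu h0,
    meanCurvatureVector_eq_sum_poissonBracket hXs hρs φ.open_target hu (hdet u hu) h0⟩
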